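/- Let $N\ge 2$ and let $\mathbb{Z}_N=\mathbb{Z}/N\mathbb{Z}$. For $g\in\mathbb{C}^N$, regarded as a function on $\mathbb{Z}_N$ (so that $g(-1)=g(N-1)$), put $\hat g(k)=\sum_{t\in\mathbb{Z}_N}g(t)e^{-2\pi i kt/N}$. For $\Omega\subseteq\mathbb{Z}_N$ and $f\in\mathbb{C}^N$ consider the one-dimensional total-variation problem $$(\mathrm{TV})\qquad \min_{g\in\mathbb{C}^N}\ \sum_{t\in\mathbb{Z}_N}|g(t)-g(t-1)|\qquad\text{subject to}\quad \hat g(k)=\hat f(k)\ \text{ for all } k\in\Omega .$$ There is an absolute constant $c>0$ such that, with $\alpha(M)=c/(M+1)$, the following holds. For every $M>0$ there is a constant $C=C(M)>0$, depending only on $M$, such that for every $N\ge 2$, every $\tau\in(0,1)$ and every $f\in\mathbb{C}^N$ whose jump set $T=\{t\in\mathbb{Z}_N: f(t)\ne f(t-1)\}$ satisfies $$|T|\le\alpha(M)\,(\log N)^{-1}\,\tau N ,$$ if $\Omega=\{k\in\mathbb{Z}_N: I_k=1\}$, where $(I_k)_{k\in\mathbb{Z}_N}$ are independent Bernoulli random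 variables with $\mathbf{P}(I_k=1)=\tau$, then with probability at least $1-CN^{-M}$ the minimizer of $(\mathrm{TV})$, adjusted so that its sum is $\hat f(0)$, is unique and equal to $f$; that is, $f$ is a minimizer of $(\mathrm{TV})$, and it is the only minimizer $g$ with $\sum_t g(t)=\hat f(0)$. (If $0\in\Omega$ the condition on the sum is implied by the constraint; if $0\notin\Omega$ it fixes the additive constant, under which $(\mathrm{TV})$ is invariant.) -/

import Mathlib

open MeasureTheory ProbabilityTheory
open scoped ZMod

/-- The one-dimensional (periodic) total variation `∑ₜ |g(t) - g(t-1)|` of a signal on `ℤ/N`,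
indices being taken modulo `N`, so that `g(-1) = g(N-1)`. -/
noncomputable def totalVariation {N : ℕ} [NeZero N] (g : ZMod N → ℂ) : ℝ :=
  ∑ t : ZMod N, ‖g t - g (t - 1)‖

/-- The jump set `{t : f(t) ≠ f(t-1)}`, indices being taken modulo `N`. -/
def jumpSet {N : ℕ} (f : ZMod N → ℂ) : Set (ZMod N) :=
  {t | f t ≠ f (t - 1)}

/-- The signals `g` whose discrete Fourier transform agrees with that of `f` on the set `Ω` of
frequencies. Here `𝓕 f k = ∑ₜ f(t) exp(-2πikt/N)`. -/
def feasibleSet {N : ℕ} [NeZero N] (Ω : Set (ZMod N)) (f : ZMod N → ℂ) : Set (ZMod N → ℂ) :=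
  {g | Set.EqOn (𝓕 g) (𝓕 f) Ω}

/-- `g` is a solution of the problem of minimizing the total variation among the signals whose
Fourier transform agrees with that of `f` on `Ω`. -/
def IsTVMinimizer {N : ℕ} [NeZero N] (Ω : Set (ZMod N)) (f g : ZMod N → ℂ) : Prop :=
  g ∈ feasibleSet Ω f ∧ IsMinOn totalVariation (feasibleSet Ω f) g

/-- Total-variation minimization recovers `f` uniquely from its Fourier transform on `Ω`: the
solution `g`, adjusted so that `∑ g(t)` is `𝓕 f 0` (if `0 ∈ Ω` this is no restriction; if `0 ∉ Ω`
it fixes the additive constant, which neither the objective nor the constraint sees), is unique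
and equals `f`. -/
def TVRecovers {N : ℕ} [NeZero N] (Ω : Set (ZMod N)) (f : ZMod N → ℂ) : Prop :=
  {g | IsTVMinimizer Ω f g ∧ ∑ t : ZMod N, g t = 𝓕 f 0} = {f}

/-- The law of the random set of frequencies `{k : I_k = 1}`, for independent Bernoulli
variables `I_k`, `k ∈ ℤ/N`, each of which is `1` with probability `τ`. -/
noncomputable def randomFrequencies (N : ℕ) (τ : unitInterval) : Measure (Set (ZMod N)) :=
  setBernoulli Set.univ τ

/-!
The proof builds dual certificates by a golfing iteration with adaptive step sizes.

Passing to the difference signal `x(t) = f(t) - f(t-1)`, which is supported on the jump set `T`,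
reduces the claim to uniqueness of `x` as an `ℓ¹`-minimizer among the signals with the same Fourier
transform on `Ω` (`tvRecovers_of_l1_unique`). By duality this holds if, for each of the `|T| + 1`
targets consisting of the sign pattern of `x` and the unit vectors `e_j`, `j ∈ T`, there is a vector
with spectrum in `Ω` that agrees with the target on `T` up to `1/(4N)` and has modulus at most `2/3`
outside `T` (`eq_zero_of_hasDualCertificate`). The vectors for the `e_j` give the injectivity of the
partial Fourier transform on `T` in a quantitative form, so that no bound for a random matrix is
needed. It remains to show that one fixed target `q₀` has such a certificate with probability
`1 - O(N^{-2(M+1)})` (`bernoulliExp_not_hasDualCertificate_le`), and to take a union bound.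

The random set `Ω` is distributed as the union of `n ≈ 300 (M + 1) log N` independent Bernoulli sets
`S`, each of parameter `p` with `K = pN/|T| ≥ 1024`. For a fixed vector `q` supported on `T` the
partial inversion `A_S q = (pN)⁻¹ ∑_{k ∈ S} q̂(k) exp(2πik·/N)` is an unbiased estimator of `q`. Let
`r` be the quadratic mean of `q` over `T`. The error on `T` has mean square at most `r²/K`, and at a
point outside `T` the variable `θ Re A_S q` has exponential moment at most `exp(θ² r²/K)` as long as
`θ r ≤ K`. Starting from `v = 0`, a step replaces `v` by `v + η A_S q`, where `q` is the residual
`q₀ - v` on `T`; if `S` is a bad sample, which happens with probability at most `1/100`, it is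
skipped.

With only a constant oversampling factor per step, a full step `η = 1` at the beginning would make
`v` too large outside `T`. The step is therefore chosen such that `lam η r = 32`, with `lam` a
multiple of `(M + 1) log N`, until `r ≤ 32 / lam`; from then on full steps are harmless. Each usable
step of the first kind lowers `r` by `16 / lam`, so that `lam r / 8` drops by `2`, which outweighs
both the exponential moment of the increment and the chance of skipping. Hence
`exp(lam (Re (i^j v(t)) + r/8 + …))` is a supermartingale
(`bernoulliExp_sizePotential_golfingStep_le`), which bounds `v` outside `T` at the price of a single
factor `log N`. A second potential `(r/ρ)² exp(lam r / 16)` is halved on average by every step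
(`bernoulliExp_timePotential_golfingStep_le`) and shows that `n` steps suffice.
-/

/-! ### Finite expectations over Bernoulli random sets -/

section BernoulliExpectation

variable {ι : Type*} [Fintype ι] [DecidableEq ι]

/-- The expectation of `F S`, where the random set `S ⊆ ι` contains each `i` independently with
probability `p`, written as a finite sum. -/
noncomputable def bernoulliExp (p : ℝ) (F : Finset ι → ℝ) : ℝ :=
  ∑ S : Finset ι, (∏ i, if i ∈ S then p else 1 - p) * F S

/-- Independence: the expectation of a product of functions of the single memberships factors. -/
lemma bernoulliExp_prod (p : ℝ) (a b : ι → ℝ) :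
    bernoulliExp p (fun S => ∏ i, if i ∈ S then a i else b i)
      = ∏ i, (p * a i + (1 - p) * b i) := by
  rw [Finset.prod_add, Finset.powerset_univ]
  refine Finset.sum_congr rfl fun S _ => ?_
  rw [← Finset.prod_mul_distrib, ← Finset.prod_mul_prod_compl S, ← Finset.compl_eq_univ_sdiff]
  congr 1
  · exact Finset.prod_congr rfl fun i hi => by simp [hi]
  · exact Finset.prod_congr rfl fun i hi => by simp [Finset.mem_compl.1 hi]

lemma bernoulliExp_const (p c : ℝ) : bernoulliExp (ι := ι) p (fun _ => c) = c := by
  have h := bernoulliExp_prod (ι := ι) p (fun _ => 1) (fun _ => 1)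
  simp only [ite_self, Finset.prod_const_one, mul_one, add_sub_cancel] at h
  rw [bernoulliExp] at h ⊢
  rw [← Finset.sum_mul]
  simp only [mul_one] at h
  rw [h, one_mul]

lemma bernoulliExp_add (p : ℝ) (F G : Finset ι → ℝ) :
    bernoulliExp p (fun S => F S + G S) = bernoulliExp p F + bernoulliExp p G := by
  simp [bernoulliExp, mul_add, Finset.sum_add_distrib]

lemma bernoulliExp_mul_left (p c : ℝ) (F : Finset ι → ℝ) :
    bernoulliExp p (fun S => c * F S) = c * bernoulliExp p F := by
  simp only [bernoulliExp, Finset.mul_sum]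
  exact Finset.sum_congr rfl fun S _ => by ring

lemma bernoulliExp_sum {κ : Type*} (p : ℝ) (s : Finset κ) (F : κ → Finset ι → ℝ) :
    bernoulliExp p (fun S => ∑ j ∈ s, F j S) = ∑ j ∈ s, bernoulliExp p (F j) := by
  simp only [bernoulliExp, Finset.mul_sum]
  rw [Finset.sum_comm]

lemma bernoulliWeight_nonneg {p : ℝ} (h0 : 0 ≤ p) (h1 : p ≤ 1) (S : Finset ι) :
    0 ≤ ∏ i, if i ∈ S then p else 1 - p :=
  Finset.prod_nonneg fun i _ => by split_ifs <;> linarith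

lemma bernoulliExp_mono {p : ℝ} (h0 : 0 ≤ p) (h1 : p ≤ 1) {F G : Finset ι → ℝ}
    (h : ∀ S, F S ≤ G S) : bernoulliExp p F ≤ bernoulliExp p G :=
  Finset.sum_le_sum fun S _ => mul_le_mul_of_nonneg_left (h S) (bernoulliWeight_nonneg h0 h1 S)

lemma bernoulliExp_zero (F : Finset ι → ℝ) : bernoulliExp 0 F = F ∅ := by
  rw [bernoulliExp, Finset.sum_eq_single ∅]
  · simp
  · intro S _ hS
    obtain ⟨i, hi⟩ := Finset.nonempty_iff_ne_empty.2 hS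
    rw [Finset.prod_eq_zero (Finset.mem_univ i) (by simp [hi]), zero_mul]
  · simp

lemma prod_ite_eq_indicator (S U : Finset ι) :
    (∏ i, if i ∈ S then (if i ∈ U then (1 : ℝ) else 0) else (if i ∈ U then 0 else 1))
      = if S = U then 1 else 0 := by
  split_ifs with h
  · subst h
    exact Finset.prod_eq_one fun i _ => by split_ifs <;> rfl
  · rw [Finset.ext_iff, not_forall] at h
    obtain ⟨i, hi⟩ := h
    refine Finset.prod_eq_zero (Finset.mem_univ i) ?_
    by_cases h1 : i ∈ S <;> by_cases h2 : i ∈ U <;> simp_all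

/-- The union of two independent Bernoulli random sets is a Bernoulli random set. -/
lemma bernoulliExp_union (p q : ℝ) (F : Finset ι → ℝ) :
    bernoulliExp p (fun S₁ => bernoulliExp q fun S₂ => F (S₁ ∪ S₂))
      = bernoulliExp (1 - (1 - p) * (1 - q)) F := by
  -- `F` is a combination of indicators of single sets `U`, each a product over memberships.
  have hF : ∀ S, F S = ∑ U, F U * (∏ i, if i ∈ S then (if i ∈ U then (1 : ℝ) else 0)
      else (if i ∈ U then 0 else 1)) := fun S => by simp [prod_ite_eq_indicator]
  have h1 : ∀ S₁ S₂ : Finset ι, ∀ U : Finset ι,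
      (∏ i, if i ∈ S₁ ∪ S₂ then (if i ∈ U then (1 : ℝ) else 0) else (if i ∈ U then 0 else 1))
      = ∏ i, if i ∈ S₂ then (if i ∈ U then (1 : ℝ) else 0)
        else (if i ∈ S₁ then (if i ∈ U then (1 : ℝ) else 0) else (if i ∈ U then 0 else 1)) := by
    intro S₁ S₂ U
    refine Finset.prod_congr rfl fun i _ => ?_
    by_cases h1 : i ∈ S₁ <;> by_cases h2 : i ∈ S₂ <;> simp [h1, h2]
  have h2 : ∀ S₁ : Finset ι, ∀ U : Finset ι,
      (∏ i, (q * (if i ∈ U then (1 : ℝ) else 0) + (1 - q) *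
        (if i ∈ S₁ then (if i ∈ U then (1 : ℝ) else 0) else (if i ∈ U then 0 else 1))))
      = ∏ i, if i ∈ S₁ then (if i ∈ U then (1 : ℝ) else 0)
        else (q * (if i ∈ U then (1 : ℝ) else 0) + (1 - q) * (if i ∈ U then 0 else 1)) := by
    intro S₁ U
    refine Finset.prod_congr rfl fun i _ => ?_
    by_cases h1 : i ∈ S₁ <;> by_cases h2 : i ∈ U <;> simp [h1, h2]
  have hG : F = fun S => ∑ U, F U * (∏ i, if i ∈ S then (if i ∈ U then (1 : ℝ) else 0)
      else (if i ∈ U then 0 else 1)) := funext hF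
  rw [hG]
  simp only [bernoulliExp_sum, bernoulliExp_mul_left, h1, bernoulliExp_prod, h2]
  refine Finset.sum_congr rfl fun U _ => ?_
  congr 1
  exact Finset.prod_congr rfl fun i _ => by ring

/-- A Bennett-type bound for the exponential moments of a sum over a Bernoulli random set. -/
lemma bernoulliExp_exp_sum_le {p : ℝ} (h0 : 0 ≤ p) (h1 : p ≤ 1) (a : ι → ℝ)
    (ha : ∀ i, |a i| ≤ 1) :
    bernoulliExp p (fun S => Real.exp (∑ i ∈ S, a i))
      ≤ Real.exp (p * ∑ i, a i + p * ∑ i, a i ^ 2) := by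
  have h : ∀ S : Finset ι, Real.exp (∑ i ∈ S, a i)
      = ∏ i, if i ∈ S then Real.exp (a i) else 1 := by
    intro S
    rw [Real.exp_sum, Finset.prod_ite_mem, Finset.univ_inter]
  simp only [h, bernoulliExp_prod]
  rw [Finset.mul_sum, Finset.mul_sum, ← Finset.sum_add_distrib, Real.exp_sum]
  refine Finset.prod_le_prod (fun i _ => by nlinarith [Real.exp_pos (a i)]) fun i _ => ?_
  have h3 := Real.abs_exp_sub_one_sub_id_le (ha i)
  have h4 := Real.add_one_le_exp (p * a i + p * a i ^ 2)
  nlinarith [abs_le.1 h3]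

lemma bernoulliExp_centered_mul (p : ℝ) (k l : ι) :
    bernoulliExp p (fun S => ((if k ∈ S then 1 else 0) - p) * ((if l ∈ S then 1 else 0) - p))
      = if k = l then p * (1 - p) else 0 := by
  split_ifs with hkl
  · subst hkl
    have h : ∀ S : Finset ι, ((if k ∈ S then (1 : ℝ) else 0) - p) * ((if k ∈ S then 1 else 0) - p)
        = ∏ i, if i ∈ S then (if i = k then (1 - p) ^ 2 else 1) else (if i = k then p ^ 2 else 1) := by
      intro S
      rw [Finset.prod_eq_single k]
      · by_cases hk : k ∈ S
        · simp [hk]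
          ring
        · simp [hk]
          ring
      · intro b _ hb
        simp [hb]
      · simp
    simp only [h, bernoulliExp_prod]
    rw [Finset.prod_eq_single k]
    · simp; ring
    · intro b _ hb
      simp [hb]
    · simp
  · have h : ∀ S : Finset ι, ((if k ∈ S then (1 : ℝ) else 0) - p) * ((if l ∈ S then 1 else 0) - p)
        = ∏ i, if i ∈ S then (if i = k ∨ i = l then (1 - p) else 1)
          else (if i = k ∨ i = l then -p else 1) := by
      intro S
      rw [Finset.prod_eq_mul k l hkl]
      · by_cases hk : k ∈ S <;> by_cases hl : l ∈ S <;> simp [hk, hl]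
      · intro c _ hc
        simp [hc.1, hc.2]
      · simp
      · simp
    simp only [h, bernoulliExp_prod]
    exact Finset.prod_eq_zero (Finset.mem_univ k) (by simp; ring)

/-- The variance of a complex sum over a Bernoulli random set. -/
lemma bernoulliExp_variance_le {p : ℝ} (h0 : 0 ≤ p) (c : ι → ℂ) :
    bernoulliExp p (fun S => ‖∑ i ∈ S, c i - p * ∑ i, c i‖ ^ 2) ≤ p * ∑ i, ‖c i‖ ^ 2 := by
  have h : ∀ S : Finset ι, ‖∑ i ∈ S, c i - p * ∑ i, c i‖ ^ 2
      = ∑ k, ∑ l, ((c k).re * (c l).re + (c k).im * (c l).im) *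
        (((if k ∈ S then 1 else 0) - p) * ((if l ∈ S then 1 else 0) - p)) := by
    intro S
    have h1 : ∑ i ∈ S, c i - p * ∑ i, c i
        = ∑ i, (((if i ∈ S then 1 else 0) - p : ℝ) : ℂ) * c i := by
      rw [Finset.mul_sum, ← Finset.univ_inter S, ← Finset.sum_ite_mem, ← Finset.sum_sub_distrib]
      refine Finset.sum_congr rfl fun i _ => ?_
      by_cases hi : i ∈ S
      · simp [hi]
        ring
      · simp [hi]
    rw [h1, ← Complex.normSq_eq_norm_sq, Complex.normSq_apply, Complex.re_sum, Complex.im_sum,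
      Finset.sum_mul_sum, Finset.sum_mul_sum, ← Finset.sum_add_distrib]
    refine Finset.sum_congr rfl fun k _ => ?_
    rw [← Finset.sum_add_distrib]
    refine Finset.sum_congr rfl fun l _ => ?_
    rw [Complex.re_ofReal_mul, Complex.re_ofReal_mul, Complex.im_ofReal_mul, Complex.im_ofReal_mul]
    ring
  simp only [h, bernoulliExp_sum, bernoulliExp_mul_left, bernoulliExp_centered_mul]
  rw [Finset.mul_sum]
  refine Finset.sum_le_sum fun k _ => ?_
  simp only [mul_ite, mul_zero, Finset.sum_ite_eq, Finset.mem_univ, if_true]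
  rw [← Complex.normSq_eq_norm_sq, Complex.normSq_apply]
  nlinarith [mul_nonneg (mul_nonneg h0 h0) (add_nonneg (mul_self_nonneg (c k).re)
    (mul_self_nonneg (c k).im))]

open Classical in
/-- Probabilities of the measure `setBernoulli` on a finite type are finite Bernoulli expectations. -/
lemma setBernoulli_real_eq_bernoulliExp (τ : unitInterval) (P : Set ι → Prop) :
    (setBernoulli (Set.univ : Set ι) τ).real {Ω | P Ω}
      = bernoulliExp (τ : ℝ) (fun S : Finset ι => if P (S : Set ι) then 1 else 0) := by
  have h1 : {Ω : Set ι | P Ω}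
      = ⋃ S ∈ (Finset.univ.filter fun S : Finset ι => P (S : Set ι)),
          ({(S : Set ι)} : Set (Set ι)) := by
    ext Ω
    simp only [Set.mem_ofPred_eq, Finset.mem_filter, Finset.mem_univ, true_and, Set.mem_iUnion,
      Set.mem_singleton_iff, exists_prop]
    constructor
    · intro h
      exact ⟨Ω.toFinset, by simpa using h, by simp⟩
    · rintro ⟨S, hS, rfl⟩
      exact hS
  rw [h1, measureReal_biUnion_finset]
  · rw [Finset.sum_filter, bernoulliExp]
    refine Finset.sum_congr rfl fun S _ => ?_
    split_ifs
    · rw [setBernoulli_real_singleton _ (Set.subset_univ _) Set.finite_univ, mul_one,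
        ← Finset.prod_mul_prod_compl S]
      congr 1
      · rw [Set.ncard_coe_finset, Finset.prod_congr rfl (g := fun _ => (τ : ℝ))
          (fun i hi => by simp [hi]), Finset.prod_const]
      · rw [← Set.compl_eq_univ_sdiff, ← Finset.coe_compl, Set.ncard_coe_finset,
          Finset.prod_congr rfl (g := fun _ => 1 - (τ : ℝ))
          (fun i hi => by simp [Finset.mem_compl.1 hi]), Finset.prod_const]
    · simp
  · intro S _ S' _ h
    simpa using h
  · intro S _
    exact MeasurableSet.of_discrete

end BernoulliExpectation

/-! ### Partial Fourier inversion from random frequencies -/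

section Sampling

variable {N : ℕ} [NeZero N]

/-- The signal `v` annihilates every `δ` whose Fourier transform vanishes on `Ω`; equivalently, the
Fourier transform of `v` is supported in `Ω`. -/
def AnnihilatesKernel (Ω : Set (ZMod N)) (v : ZMod N → ℂ) : Prop :=
  ∀ δ : ZMod N → ℂ, (∀ k ∈ Ω, 𝓕 δ k = 0) → ∑ t, starRingEnd ℂ (v t) * δ t = 0

/-- The rescaled partial Fourier inversion `(pN)⁻¹ ∑_{k ∈ S} q̂(k) exp(2πikt/N)`. For a Bernoulli
random set `S` of parameter `p` it is an unbiased estimator of `q`. -/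
noncomputable def partialInversion (p : ℝ) (S : Finset (ZMod N)) (q : ZMod N → ℂ) :
    ZMod N → ℂ :=
  fun t => ∑ k ∈ S, ((p * N : ℝ) : ℂ)⁻¹ * (ZMod.stdAddChar (t * k) * 𝓕 q k)

lemma norm_stdAddChar (x : ZMod N) : ‖(ZMod.stdAddChar x : ℂ)‖ = 1 := by
  rw [ZMod.stdAddChar_apply, Circle.norm_coe]

lemma conj_stdAddChar (x : ZMod N) :
    starRingEnd ℂ (ZMod.stdAddChar x : ℂ) = ZMod.stdAddChar (-x) := by
  rw [ZMod.stdAddChar_apply, ZMod.stdAddChar_apply, AddChar.map_neg_eq_inv, Circle.coe_inv_eq_conj]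

lemma AnnihilatesKernel.zero (Ω : Set (ZMod N)) : AnnihilatesKernel Ω 0 := fun δ _ => by simp

lemma AnnihilatesKernel.mono {Ω Ω' : Set (ZMod N)} (h : Ω ⊆ Ω') {v : ZMod N → ℂ}
    (hv : AnnihilatesKernel Ω v) : AnnihilatesKernel Ω' v :=
  fun δ hδ => hv δ fun k hk => hδ k (h hk)

lemma AnnihilatesKernel.add_smul {Ω : Set (ZMod N)} {v w : ZMod N → ℂ} (c : ℝ)
    (hv : AnnihilatesKernel Ω v) (hw : AnnihilatesKernel Ω w) :
    AnnihilatesKernel Ω (fun t => v t + c * w t) := by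
  intro δ hδ
  have h1 := hv δ hδ
  have h2 := hw δ hδ
  simp only [map_add, map_mul, add_mul, Finset.sum_add_distrib, mul_assoc, ← Finset.mul_sum, h1, h2,
    mul_zero, add_zero]

lemma annihilatesKernel_partialInversion (p : ℝ) (S : Finset (ZMod N)) (q : ZMod N → ℂ) :
    AnnihilatesKernel (S : Set (ZMod N)) (partialInversion p S q) := by
  intro δ hδ
  simp only [partialInversion, map_sum, Finset.sum_mul]
  rw [Finset.sum_comm]
  refine Finset.sum_eq_zero fun k hk => ?_
  have h : ∑ t, ZMod.stdAddChar (-(t * k)) * δ t = 0 := by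
    simpa [ZMod.dft_apply] using hδ k hk
  calc _ = ∑ t, starRingEnd ℂ (((p * N : ℝ) : ℂ)⁻¹) * starRingEnd ℂ (𝓕 q k) *
        (ZMod.stdAddChar (-(t * k)) * δ t) := by
        refine Finset.sum_congr rfl fun t _ => ?_
        rw [map_mul, map_mul, conj_stdAddChar]
        ring
    _ = 0 := by rw [← Finset.mul_sum, h, mul_zero]

lemma partialInversion_zero (p : ℝ) (S : Finset (ZMod N)) : partialInversion p S 0 = 0 := by
  funext t
  simp [partialInversion]

lemma sum_stdAddChar_mul_dft (q : ZMod N → ℂ) (t : ZMod N) :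
    ∑ k, ZMod.stdAddChar (t * k) * 𝓕 q k = N * q t := by
  have h := ZMod.invDFT_apply (𝓕 q) t
  rw [LinearEquiv.symm_apply_apply] at h
  have hN : (N : ℂ) ≠ 0 := NeZero.ne _
  rw [h]
  simp only [smul_eq_mul]
  rw [← mul_assoc, mul_inv_cancel₀ hN, one_mul]
  exact Finset.sum_congr rfl fun k _ => by rw [mul_comm k t]

/-- Parseval's identity on `ℤ/N`. -/
lemma sum_norm_sq_dft (q : ZMod N → ℂ) : ∑ k, ‖𝓕 q k‖ ^ 2 = N * ∑ t, ‖q t‖ ^ 2 := by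
  have h : ∑ k, starRingEnd ℂ (𝓕 q k) * 𝓕 q k = N * ∑ t, starRingEnd ℂ (q t) * q t := by
    calc ∑ k, starRingEnd ℂ (𝓕 q k) * 𝓕 q k
        = ∑ k, ∑ t, starRingEnd ℂ (q t) * (ZMod.stdAddChar (t * k) * 𝓕 q k) := by
          refine Finset.sum_congr rfl fun k _ => ?_
          rw [ZMod.dft_apply q k, map_sum, Finset.sum_mul]
          refine Finset.sum_congr rfl fun t _ => ?_
          rw [smul_eq_mul, map_mul, conj_stdAddChar, neg_neg]
          ring
      _ = _ := by
          rw [Finset.sum_comm, Finset.mul_sum]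
          refine Finset.sum_congr rfl fun t _ => ?_
          rw [← Finset.mul_sum, sum_stdAddChar_mul_dft]
          ring
  simp only [Complex.conj_mul'] at h
  exact_mod_cast h

lemma norm_sq_dft_le {T : Finset (ZMod N)} {q : ZMod N → ℂ} (hq : ∀ t ∉ T, q t = 0) (k : ZMod N) :
    ‖𝓕 q k‖ ^ 2 ≤ T.card * ∑ t, ‖q t‖ ^ 2 := by
  have h1 : ‖𝓕 q k‖ ≤ ∑ t ∈ T, ‖q t‖ := by
    rw [ZMod.dft_apply, ← Finset.sum_subset (Finset.subset_univ T) (fun t _ ht => by simp [hq t ht])]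
    refine (norm_sum_le _ _).trans (Finset.sum_le_sum fun t _ => ?_)
    rw [smul_eq_mul, norm_mul, norm_stdAddChar, one_mul]
  calc ‖𝓕 q k‖ ^ 2 ≤ (∑ t ∈ T, ‖q t‖) ^ 2 := by gcongr
    _ ≤ T.card * ∑ t ∈ T, ‖q t‖ ^ 2 := sq_sum_le_card_mul_sum_sq
    _ ≤ _ := by
      gcongr
      exact Finset.subset_univ T

lemma sum_partialInversion_coeff {p : ℝ} (hp : 0 < p) (q : ZMod N → ℂ) (t : ZMod N) :
    (p : ℂ) * ∑ k, ((p * N : ℝ) : ℂ)⁻¹ * (ZMod.stdAddChar (t * k) * 𝓕 q k) = q t := by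
  rw [← Finset.mul_sum, sum_stdAddChar_mul_dft]
  have hN : (N : ℂ) ≠ 0 := NeZero.ne _
  have hp' : (p : ℂ) ≠ 0 := by exact_mod_cast hp.ne'
  push_cast
  field_simp

lemma sum_norm_sq_partialInversion_coeff {p : ℝ} (hp : 0 < p) (q : ZMod N → ℂ) (t : ZMod N) :
    p * ∑ k, ‖((p * N : ℝ) : ℂ)⁻¹ * (ZMod.stdAddChar (t * k) * 𝓕 q k)‖ ^ 2
      = (∑ t, ‖q t‖ ^ 2) / (p * N) := by
  have hN : (0 : ℝ) < N := by exact_mod_cast NeZero.pos N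
  simp only [norm_mul, norm_stdAddChar, one_mul, mul_pow]
  rw [← Finset.mul_sum, sum_norm_sq_dft, norm_inv, Complex.norm_real, Real.norm_eq_abs,
    abs_of_pos (by positivity)]
  field_simp

/-- Exponential moments of the partial inversion at a point outside the support of `q`. -/
lemma bernoulliExp_exp_partialInversion_le {p : ℝ} (h0 : 0 < p) (h1 : p ≤ 1)
    {T : Finset (ZMod N)} {q : ZMod N → ℂ} (hq : ∀ t ∉ T, q t = 0) {t : ZMod N} (ht : t ∉ T)
    {ζ : ℂ} (hζ : ‖ζ‖ ≤ 1) {θ : ℝ} (hθ : 0 ≤ θ)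
    (hθq : θ ^ 2 * (T.card * ∑ t, ‖q t‖ ^ 2) ≤ (p * N) ^ 2) :
    bernoulliExp p (fun S => Real.exp (θ * (ζ * partialInversion p S q t).re))
      ≤ Real.exp (θ ^ 2 * ((∑ t, ‖q t‖ ^ 2) / (p * N))) := by
  have hN : (0 : ℝ) < N := by exact_mod_cast NeZero.pos N
  set c : ZMod N → ℂ := fun k => ((p * N : ℝ) : ℂ)⁻¹ * (ZMod.stdAddChar (t * k) * 𝓕 q k) with hc
  have hcn : ∀ k, ‖c k‖ = (p * N)⁻¹ * ‖𝓕 q k‖ := fun k => by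
    simp only [hc, norm_mul, norm_stdAddChar, one_mul, norm_inv, Complex.norm_real,
      Real.norm_eq_abs]
    rw [abs_of_pos (show 0 < p by positivity), abs_of_pos (show (0 : ℝ) < N by positivity)]
  have hac : ∀ k, |θ * (ζ * c k).re| ≤ θ * ‖c k‖ := fun k => by
    rw [abs_mul, abs_of_nonneg hθ]
    refine mul_le_mul_of_nonneg_left ((Complex.abs_re_le_norm _).trans ?_) hθ
    rw [norm_mul]
    exact mul_le_of_le_one_left (norm_nonneg _) hζ
  have hle : ∀ k, |θ * (ζ * c k).re| ≤ 1 := fun k => by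
    refine (hac k).trans ?_
    rw [hcn]
    refine abs_le_of_sq_le_sq' (a := θ * ((p * N)⁻¹ * ‖𝓕 q k‖)) ?_ zero_le_one |>.2
    have := mul_le_mul_of_nonneg_left (norm_sq_dft_le hq k) (sq_nonneg θ)
    rw [mul_pow, mul_pow, inv_pow, one_pow]
    rw [show θ ^ 2 * (((p * N) ^ 2)⁻¹ * ‖𝓕 q k‖ ^ 2) = (θ ^ 2 * ‖𝓕 q k‖ ^ 2) / (p * N) ^ 2 by
      field_simp, div_le_one (by positivity)]
    exact this.trans hθq
  have key := bernoulliExp_exp_sum_le h0.le h1 (fun k => θ * (ζ * c k).re) hle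
  have e1 : ∀ S : Finset (ZMod N), θ * (ζ * partialInversion p S q t).re
      = ∑ k ∈ S, θ * (ζ * c k).re := fun S => by
    rw [partialInversion, Finset.mul_sum, Complex.re_sum, Finset.mul_sum]
  simp only [e1]
  refine key.trans (Real.exp_le_exp.2 ?_)
  have e2 : p * ∑ k, θ * (ζ * c k).re = 0 := by
    have h := sum_partialInversion_coeff h0 q t
    rw [hq t ht] at h
    have hp' : (p : ℂ) ≠ 0 := by exact_mod_cast h0.ne'
    have h' : ∑ k, c k = 0 := (mul_eq_zero.1 h).resolve_left hp'
    rw [← Finset.mul_sum, ← Complex.re_sum, ← Finset.mul_sum, h']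
    simp
  rw [e2, zero_add, ← sum_norm_sq_partialInversion_coeff h0 q t]
  calc p * ∑ k, (θ * (ζ * c k).re) ^ 2 ≤ p * ∑ k, θ ^ 2 * ‖c k‖ ^ 2 := by
        refine mul_le_mul_of_nonneg_left (Finset.sum_le_sum fun k _ => ?_) h0.le
        rw [← mul_pow]
        exact sq_le_sq' (neg_le_of_abs_le (hac k)) (le_of_abs_le (hac k))
    _ = _ := by
        rw [← Finset.mul_sum]
        ring

/-- The mean square error of the partial inversion on `T`. -/
lemma bernoulliExp_sum_norm_sq_sub_le {p : ℝ} (h0 : 0 < p)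
    (T : Finset (ZMod N)) (q : ZMod N → ℂ) :
    bernoulliExp p (fun S => ∑ t ∈ T, ‖q t - partialInversion p S q t‖ ^ 2)
      ≤ T.card * ((∑ t, ‖q t‖ ^ 2) / (p * N)) := by
  rw [bernoulliExp_sum, ← nsmul_eq_mul]
  refine Finset.sum_le_card_nsmul _ _ _ fun t _ => ?_
  have h := bernoulliExp_variance_le h0.le
    (fun k => ((p * N : ℝ) : ℂ)⁻¹ * (ZMod.stdAddChar (t * k) * 𝓕 q k))
  rw [sum_norm_sq_partialInversion_coeff h0, sum_partialInversion_coeff h0] at h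
  simpa only [partialInversion, norm_sub_rev] using h

end Sampling

/-! ### The golfing iteration -/

section Golfing

variable {N : ℕ}

/-- The part of `q₀` on `T` that is not yet matched by the current dual vector `v`. -/
def unmatched (T : Finset (ZMod N)) (q₀ v : ZMod N → ℂ) : ZMod N → ℂ :=
  fun t => if t ∈ T then q₀ t - v t else 0

lemma unmatched_of_notMem {T : Finset (ZMod N)} {q₀ v : ZMod N → ℂ} {t : ZMod N} (ht : t ∉ T) :
    unmatched T q₀ v t = 0 := by
  simp [unmatched, ht]

variable [NeZero N]

/-- The quadratic mean over `T` of the residual. -/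
noncomputable def residualMean (T : Finset (ZMod N)) (q₀ v : ZMod N → ℂ) : ℝ :=
  √((∑ t, ‖unmatched T q₀ v t‖ ^ 2) / T.card)

/-- The step size of the golfing iteration at a residual of quadratic mean `r`: the full step once
`lam * r ≤ 32`, and before that the step for which `lam * stepSize lam r * r = 32`. -/
noncomputable def stepSize (lam r : ℝ) : ℝ := if lam * r ≤ 32 then 1 else 32 / (lam * r)

/-- The sample `S` is used if it estimates the residual `q` on `T` within relative error `1/2` and,
when a full step is to be taken, if it also leaves only values of size `u * r` outside `T`. -/
def IsUsable (T : Finset (ZMod N)) (q₀ : ZMod N → ℂ) (p lam u : ℝ) (v : ZMod N → ℂ)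
    (S : Finset (ZMod N)) : Prop :=
  ∑ t ∈ T, ‖unmatched T q₀ v t - partialInversion p S (unmatched T q₀ v) t‖ ^ 2
      ≤ 1 / 4 * ∑ t, ‖unmatched T q₀ v t‖ ^ 2 ∧
    (lam * residualMean T q₀ v ≤ 32 →
      ∀ t ∉ T, ‖partialInversion p S (unmatched T q₀ v) t‖ ≤ u * residualMean T q₀ v)

open Classical in
/-- One step of the golfing iteration with the sample `S`; unusable samples are skipped. -/
noncomputable def golfingStep (T : Finset (ZMod N)) (q₀ : ZMod N → ℂ) (p lam u : ℝ)
    (v : ZMod N → ℂ) (S : Finset (ZMod N)) : ZMod N → ℂ :=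
  if IsUsable T q₀ p lam u v S then
    fun t => v t + (stepSize lam (residualMean T q₀ v) : ℝ) *
      partialInversion p S (unmatched T q₀ v) t
  else v

variable {T : Finset (ZMod N)} {q₀ v : ZMod N → ℂ} {p lam u : ℝ}

lemma residualMean_nonneg : 0 ≤ residualMean T q₀ v := Real.sqrt_nonneg _

lemma sum_norm_sq_unmatched (hT : T.Nonempty) :
    ∑ t, ‖unmatched T q₀ v t‖ ^ 2 = T.card * residualMean T q₀ v ^ 2 := by
  have hs : (0 : ℝ) < T.card := by exact_mod_cast hT.card_pos
  rw [residualMean, Real.sq_sqrt (by positivity)]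
  field_simp

lemma unmatched_eq_zero (hT : T.Nonempty) (h : residualMean T q₀ v = 0) :
    unmatched T q₀ v = 0 := by
  have h1 := sum_norm_sq_unmatched (q₀ := q₀) (v := v) hT
  rw [h] at h1
  funext t
  have h2 := (Finset.sum_eq_zero_iff_of_nonneg (fun t _ => by positivity)).1
    (h1.trans (by simp)) t (Finset.mem_univ t)
  simpa using h2

lemma golfingStep_of_residualMean_eq_zero (hT : T.Nonempty) (h : residualMean T q₀ v = 0)
    (S : Finset (ZMod N)) : golfingStep T q₀ p lam u v S = v := by
  rw [golfingStep, unmatched_eq_zero hT h, partialInversion_zero]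
  split_ifs <;> simp

lemma AnnihilatesKernel.golfingStep {Ω : Set (ZMod N)} (hv : AnnihilatesKernel Ω v)
    (S : Finset (ZMod N)) :
    AnnihilatesKernel (Ω ∪ S) (golfingStep T q₀ p lam u v S) := by
  unfold _root_.golfingStep
  split_ifs
  · exact (hv.mono Set.subset_union_left).add_smul _
      ((annihilatesKernel_partialInversion p S _).mono Set.subset_union_right)
  · exact hv.mono Set.subset_union_left

lemma stepSize_nonneg {r : ℝ} : 0 ≤ stepSize lam r := by
  unfold stepSize
  split_ifs with h
  · exact zero_le_one
  · have : 0 < lam * r := by linarith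
    positivity

lemma stepSize_le_one {r : ℝ} : stepSize lam r ≤ 1 := by
  unfold stepSize
  split_ifs with h
  · exact le_rfl
  · push Not at h
    exact (div_le_one (by linarith)).2 h.le

/-- A usable sample contracts the residual. -/
lemma residualMean_golfingStep_le {S : Finset (ZMod N)} (h : IsUsable T q₀ p lam u v S) :
    residualMean T q₀ (golfingStep T q₀ p lam u v S)
      ≤ (1 - stepSize lam (residualMean T q₀ v) / 2) * residualMean T q₀ v := by
  set r := residualMean T q₀ v with hr
  set η := stepSize lam r with hη
  have h0 : 0 ≤ η := stepSize_nonneg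
  have h1 : η ≤ 1 := stepSize_le_one
  set q := unmatched T q₀ v with hq
  have hstep : ∀ t ∈ T, unmatched T q₀ (golfingStep T q₀ p lam u v S) t
      = ((1 - η : ℝ) : ℂ) * q t + (η : ℂ) * (q t - partialInversion p S q t) := fun t ht => by
    rw [golfingStep, if_pos h, hq]
    simp only [unmatched, ht, if_true, ← hr, ← hη]
    push_cast
    ring
  have hsum : ∑ t, ‖q t‖ ^ 2 = ∑ t ∈ T, ‖q t‖ ^ 2 :=
    (Finset.sum_subset (Finset.subset_univ T)
      (fun t _ ht => by rw [hq, unmatched_of_notMem ht]; simp)).symm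
  have key : ∑ t, ‖unmatched T q₀ (golfingStep T q₀ p lam u v S) t‖ ^ 2
      ≤ (1 - η / 2) ^ 2 * ∑ t, ‖q t‖ ^ 2 := by
    rw [← Finset.sum_subset (Finset.subset_univ T)
      (fun t _ ht => by rw [unmatched_of_notMem ht]; simp)]
    calc _ ≤ ∑ t ∈ T, (((1 - η) ^ 2 + η * (1 - η) / 2) * ‖q t‖ ^ 2
          + (2 * η * (1 - η) + η ^ 2) * ‖q t - partialInversion p S q t‖ ^ 2) := by
          refine Finset.sum_le_sum fun t ht => ?_
          rw [hstep t ht]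
          have h2 : ‖((1 - η : ℝ) : ℂ) * q t + (η : ℂ) * (q t - partialInversion p S q t)‖
              ≤ (1 - η) * ‖q t‖ + η * ‖q t - partialInversion p S q t‖ := by
            refine (norm_add_le _ _).trans (le_of_eq ?_)
            rw [norm_mul, norm_mul, Complex.norm_real, Complex.norm_real, Real.norm_eq_abs,
              Real.norm_eq_abs, abs_of_nonneg h0, abs_of_nonneg (by linarith)]
          refine (pow_le_pow_left₀ (norm_nonneg _) h2 2).trans ?_
          -- The cross term is split with the weights of `2ab ≤ a²/2 + 2b²`.
          nlinarith [mul_nonneg (mul_nonneg h0 (sub_nonneg.2 h1))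
            (sq_nonneg (‖q t‖ - 2 * ‖q t - partialInversion p S q t‖))]
      _ = ((1 - η) ^ 2 + η * (1 - η) / 2) * ∑ t, ‖q t‖ ^ 2
          + (2 * η * (1 - η) + η ^ 2) * ∑ t ∈ T, ‖q t - partialInversion p S q t‖ ^ 2 := by
          rw [Finset.sum_add_distrib, ← Finset.mul_sum, ← Finset.mul_sum, hsum]
      _ ≤ ((1 - η) ^ 2 + η * (1 - η) / 2) * ∑ t, ‖q t‖ ^ 2
          + (2 * η * (1 - η) + η ^ 2) * (1 / 4 * ∑ t, ‖q t‖ ^ 2) := by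
          gcongr
          exact h.1
      _ = _ := by ring
  calc residualMean T q₀ (golfingStep T q₀ p lam u v S)
      ≤ √((1 - η / 2) ^ 2 * ((∑ t, ‖q t‖ ^ 2) / T.card)) := by
        refine Real.sqrt_le_sqrt ?_
        rw [← mul_div_assoc]
        gcongr
    _ = _ := by
        rw [Real.sqrt_mul (sq_nonneg _), Real.sqrt_sq (by linarith)]
        rfl

lemma residualMean_golfingStep_le_self (S : Finset (ZMod N)) :
    residualMean T q₀ (golfingStep T q₀ p lam u v S) ≤ residualMean T q₀ v := by
  by_cases h : IsUsable T q₀ p lam u v S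
  · refine (residualMean_golfingStep_le h).trans ?_
    have h0 : 0 ≤ stepSize lam (residualMean T q₀ v) := stepSize_nonneg
    nlinarith [residualMean_nonneg (T := T) (q₀ := q₀) (v := v)]
  · rw [golfingStep, if_neg h]

/-- One of the four rotations of `z` by a right angle has a real part comparable to `‖z‖`. -/
lemma exists_norm_le_two_mul_re (z : ℂ) :
    ∃ j ∈ Finset.range 4, ‖z‖ ≤ 2 * (Complex.I ^ j * z).re := by
  have h := Complex.norm_le_abs_re_add_abs_im z
  have hI : Complex.I ^ 3 = -Complex.I := Complex.I_pow_three
  rcases le_total |z.re| |z.im| with h1 | h1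
  · rcases abs_cases z.im with h2 | h2
    · exact ⟨3, by simp, by rw [hI]; simp; linarith⟩
    · exact ⟨1, by simp, by simp; linarith⟩
  · rcases abs_cases z.re with h2 | h2
    · exact ⟨0, by simp, by simp; linarith⟩
    · exact ⟨2, by simp, by simp; linarith⟩

open Classical in
/-- A sample is unusable with small probability: Chebyshev's inequality controls the error on `T`,
and a Chernoff bound with exponent `(pN/|T|) / r` the values outside `T`. -/
lemma bernoulliExp_not_isUsable_le (hT : T.Nonempty) (h1 : p ≤ 1)
    (hp : 1024 * (T.card : ℝ) ≤ p * N) (hu : u = 2 + (Real.log N + 10) / 512)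
    (hr : 0 < residualMean T q₀ v) :
    bernoulliExp p (fun S => if IsUsable T q₀ p lam u v S then 0 else 1) ≤ 1 / 100 := by
  have hN : (0 : ℝ) < N := by exact_mod_cast NeZero.pos N
  have hs : (0 : ℝ) < T.card := by exact_mod_cast hT.card_pos
  have h0 : 0 < p := by
    by_contra h
    nlinarith
  set r := residualMean T q₀ v with hrdef
  set q := unmatched T q₀ v with hq
  have hqT : ∀ t ∉ T, q t = 0 := fun t ht => unmatched_of_notMem ht
  have hE : ∑ t, ‖q t‖ ^ 2 = T.card * r ^ 2 := sum_norm_sq_unmatched hT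
  have hEpos : 0 < ∑ t, ‖q t‖ ^ 2 := by rw [hE]; positivity
  set θ : ℝ := p * N / T.card / r with hθ
  have hθ0 : 0 ≤ θ := by positivity
  have hpt : ∀ S, (if IsUsable T q₀ p lam u v S then (0 : ℝ) else 1)
      ≤ 4 / (∑ t, ‖q t‖ ^ 2) * ∑ t ∈ T, ‖q t - partialInversion p S q t‖ ^ 2
        + ∑ t ∈ Tᶜ, ∑ j ∈ Finset.range 4, Real.exp (-(θ * (u * r / 2))) *
          Real.exp (θ * (Complex.I ^ j * partialInversion p S q t).re) := by
    intro S
    have hA : 0 ≤ 4 / (∑ t, ‖q t‖ ^ 2) * ∑ t ∈ T, ‖q t - partialInversion p S q t‖ ^ 2 := by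
      positivity
    have hB : 0 ≤ ∑ t ∈ Tᶜ, ∑ j ∈ Finset.range 4, Real.exp (-(θ * (u * r / 2))) *
          Real.exp (θ * (Complex.I ^ j * partialInversion p S q t).re) :=
      Finset.sum_nonneg fun t _ => Finset.sum_nonneg fun j _ => by positivity
    split_ifs with h
    · exact add_nonneg hA hB
    · by_cases h2 : ∑ t ∈ T, ‖q t - partialInversion p S q t‖ ^ 2 ≤ 1 / 4 * ∑ t, ‖q t‖ ^ 2
      · have h3 : ∃ t ∉ T, u * r < ‖partialInversion p S q t‖ := by
          by_contra! h3
          exact h ⟨h2, fun _ => h3⟩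
        obtain ⟨t, ht, h3⟩ := h3
        obtain ⟨j, hj, h4⟩ := exists_norm_le_two_mul_re (partialInversion p S q t)
        refine le_trans ?_ (le_add_of_nonneg_left hA)
        refine le_trans ?_ (Finset.single_le_sum (fun t _ => Finset.sum_nonneg fun j _ => by
          positivity) (Finset.mem_compl.2 ht))
        refine le_trans ?_ (Finset.single_le_sum (fun j _ => by positivity) hj)
        rw [← Real.exp_add, Real.one_le_exp_iff]
        nlinarith
      · refine le_trans ?_ (le_add_of_nonneg_right hB)
        rw [div_mul_eq_mul_div, one_le_div hEpos]
        linarith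
  refine (bernoulliExp_mono h0.le h1 hpt).trans ?_
  rw [bernoulliExp_add, bernoulliExp_mul_left, bernoulliExp_sum p Tᶜ]
  have hA : 4 / (∑ t, ‖q t‖ ^ 2) * bernoulliExp p
      (fun S => ∑ t ∈ T, ‖q t - partialInversion p S q t‖ ^ 2) ≤ 4 / 1024 := by
    calc _ ≤ 4 / (∑ t, ‖q t‖ ^ 2) * (T.card * ((∑ t, ‖q t‖ ^ 2) / (p * N))) := by
          gcongr
          exact bernoulliExp_sum_norm_sq_sub_le h0 T q
      _ = 4 * (T.card / (p * N)) := by field_simp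
      _ ≤ 4 * (1 / 1024) := by
          refine mul_le_mul_of_nonneg_left ?_ (by norm_num)
          rw [div_le_iff₀ (by positivity)]
          linarith
      _ = _ := by norm_num
  have hB : ∑ t ∈ Tᶜ, bernoulliExp p (fun S => ∑ j ∈ Finset.range 4,
      Real.exp (-(θ * (u * r / 2))) *
        Real.exp (θ * (Complex.I ^ j * partialInversion p S q t).re)) ≤ 4 * Real.exp (-10) := by
    have hterm : ∀ t ∈ Tᶜ, bernoulliExp p (fun S => ∑ j ∈ Finset.range 4,
        Real.exp (-(θ * (u * r / 2))) *
        Real.exp (θ * (Complex.I ^ j * partialInversion p S q t).re))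
        ≤ 4 * (Real.exp (-10) / N) := by
      intro t ht
      rw [bernoulliExp_sum]
      have hj : ∀ j ∈ Finset.range 4, bernoulliExp p (fun S => Real.exp (-(θ * (u * r / 2))) *
        Real.exp (θ * (Complex.I ^ j * partialInversion p S q t).re)) ≤ Real.exp (-10) / N := by
        intro j _
        rw [bernoulliExp_mul_left]
        have h5 := bernoulliExp_exp_partialInversion_le h0 h1 hqT (Finset.mem_compl.1 ht)
          (ζ := Complex.I ^ j) (by simp) hθ0 (by
            rw [hE, hθ]
            refine le_of_eq ?_
            field_simp)
        refine (mul_le_mul_of_nonneg_left h5 (Real.exp_pos _).le).trans ?_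
        rw [← Real.exp_add, ← Real.exp_log hN, ← Real.exp_sub, Real.exp_le_exp, hE,
          Real.exp_log hN]
        have e1 : θ * (u * r / 2) = p * N / T.card * (u / 2) := by
          rw [hθ]; field_simp
        have e2 : θ ^ 2 * (T.card * r ^ 2 / (p * N)) = p * N / T.card := by
          rw [hθ]; field_simp
        have e3 : 1024 ≤ p * N / T.card := by rwa [le_div_iff₀ hs]
        have e4 : 0 ≤ Real.log N := Real.log_natCast_nonneg N
        rw [e1, e2, hu]
        nlinarith
      refine (Finset.sum_le_card_nsmul _ _ _ hj).trans ?_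
      simp
    refine (Finset.sum_le_card_nsmul _ _ _ hterm).trans ?_
    rw [nsmul_eq_mul]
    have hc : ((Tᶜ).card : ℝ) ≤ N := by
      have := Finset.card_le_univ (Tᶜ)
      rw [ZMod.card] at this
      exact_mod_cast this
    calc ((Tᶜ).card : ℝ) * (4 * (Real.exp (-10) / N)) ≤ N * (4 * (Real.exp (-10) / N)) := by
          gcongr
      _ = _ := by field_simp
  have hexp : Real.exp (-10) ≤ 1 / 1024 := by
    rw [Real.exp_neg, ← one_div]
    refine one_div_le_one_div_of_le (by norm_num) ?_
    have h2 : (2 : ℝ) ≤ Real.exp 1 := by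
      have := Real.add_one_le_exp (1 : ℝ)
      linarith
    calc (1024 : ℝ) = 2 ^ 10 := by norm_num
      _ ≤ Real.exp 1 ^ 10 := by gcongr
      _ = Real.exp 10 := by rw [← Real.exp_nat_mul]; norm_num
  linarith

end Golfing

/-! ### Potentials and the existence of dual certificates -/

section Potential

variable {N : ℕ} [NeZero N]

/-- The potential that controls one real component `x` of the dual vector at a point outside `T`,
when the residual has quadratic mean `r`. The terms in `r` pay for the future increments of `x`. -/
noncomputable def sizePotential (lam u r x : ℝ) : ℝ :=
  Real.exp (lam * (x + r / 8 + 2 * u * min r (32 / lam) - 1 / 3))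

/-- The potential that controls the number of steps still needed to bring the quadratic mean `r` of
the residual below `ρ`. -/
noncomputable def timePotential (lam ρ r : ℝ) : ℝ := (r / ρ) ^ 2 * Real.exp (lam * r / 16)

variable {T : Finset (ZMod N)} {q₀ v : ZMod N → ℂ} {p lam u ρ : ℝ}

open Classical in
/-- Outside `T` the size potential does not increase on average in a step. As long as the residual
is large, its decrease in a usable step outweighs the exponential moment of the increment; later
the bound that usable samples satisfy outside `T` gives this for every sample. -/
lemma bernoulliExp_sizePotential_golfingStep_le (hT : T.Nonempty) (h1 : p ≤ 1)
    (hp : 1024 * (T.card : ℝ) ≤ p * N) (hu : u = 2 + (Real.log N + 10) / 512)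
    (hlam : 0 < lam) {t : ZMod N} (ht : t ∉ T) {ζ : ℂ} (hζ : ‖ζ‖ ≤ 1) :
    bernoulliExp p (fun S => sizePotential lam u
        (residualMean T q₀ (golfingStep T q₀ p lam u v S))
        (ζ * golfingStep T q₀ p lam u v S t).re)
      ≤ sizePotential lam u (residualMean T q₀ v) (ζ * v t).re := by
  have hN : (0 : ℝ) < N := by exact_mod_cast NeZero.pos N
  have hs : (0 : ℝ) < T.card := by exact_mod_cast hT.card_pos
  have h0 : 0 < p := by
    by_contra h
    nlinarith
  have hu0 : 0 ≤ u := by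
    have := Real.log_natCast_nonneg N
    rw [hu]
    positivity
  rcases (residualMean_nonneg (T := T) (q₀ := q₀) (v := v)).eq_or_lt with hr0 | hr0
  · simp only [golfingStep_of_residualMean_eq_zero hT hr0.symm]
    rw [bernoulliExp_const]
  set r := residualMean T q₀ v with hr
  by_cases hphase : lam * r ≤ 32
  · refine (bernoulliExp_mono h0.le h1 fun S => ?_).trans_eq (bernoulliExp_const p _)
    by_cases hS : IsUsable T q₀ p lam u v S
    · have hr' := residualMean_golfingStep_le hS
      have hv' : golfingStep T q₀ p lam u v S t
          = v t + partialInversion p S (unmatched T q₀ v) t := by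
        rw [golfingStep, if_pos hS, stepSize, if_pos hphase, Complex.ofReal_one, one_mul]
      rw [← hr, stepSize, if_pos hphase] at hr'
      have hA : (ζ * partialInversion p S (unmatched T q₀ v) t).re ≤ u * r := by
        refine (Complex.re_le_norm _).trans ?_
        rw [norm_mul]
        exact (mul_le_of_le_one_left (norm_nonneg _) hζ).trans (hS.2 hphase t ht)
      have hrlam : r ≤ 32 / lam := by
        rw [le_div_iff₀ hlam]
        linarith
      rw [hv', mul_add, Complex.add_re]
      refine Real.exp_le_exp.2 (mul_le_mul_of_nonneg_left ?_ hlam.le)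
      rw [min_eq_left hrlam]
      have h2 : 2 * u * min (residualMean T q₀ (golfingStep T q₀ p lam u v S)) (32 / lam)
          ≤ 2 * u * (r / 2) :=
        mul_le_mul_of_nonneg_left ((min_le_left _ _).trans (by linarith)) (by positivity)
      linarith
    · rw [golfingStep, if_neg hS]
  · push Not at hphase
    have hη : stepSize lam r = 32 / (lam * r) := by rw [stepSize, if_neg (not_le.2 hphase)]
    set P := sizePotential lam u r (ζ * v t).re with hP
    have hPpos : 0 < P := Real.exp_pos _
    have hpt : ∀ S, sizePotential lam u (residualMean T q₀ (golfingStep T q₀ p lam u v S))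
        (ζ * golfingStep T q₀ p lam u v S t).re
        ≤ P * (Real.exp (-2) *
            Real.exp (32 / r * (ζ * partialInversion p S (unmatched T q₀ v) t).re)
          + if IsUsable T q₀ p lam u v S then 0 else 1) := by
      intro S
      by_cases hS : IsUsable T q₀ p lam u v S
      · have hr' := residualMean_golfingStep_le hS
        have hv' : golfingStep T q₀ p lam u v S t
            = v t + ((32 / (lam * r) : ℝ) : ℂ) *
              partialInversion p S (unmatched T q₀ v) t := by
          rw [golfingStep, if_pos hS, ← hr, hη]
        rw [← hr, hη] at hr'
        have hr'' : residualMean T q₀ (golfingStep T q₀ p lam u v S) ≤ r - 16 / lam := by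
          refine hr'.trans_eq ?_
          field_simp
          ring
        have hmin : min (residualMean T q₀ (golfingStep T q₀ p lam u v S)) (32 / lam)
            ≤ min r (32 / lam) :=
          min_le_min (residualMean_golfingStep_le_self S) le_rfl
        rw [if_pos hS, add_zero, hP, sizePotential, sizePotential, ← Real.exp_add, ← Real.exp_add,
          Real.exp_le_exp, hv', mul_add, Complex.add_re, mul_left_comm, Complex.re_ofReal_mul]
        have e1 : lam * (32 / (lam * r) *
            (ζ * partialInversion p S (unmatched T q₀ v) t).re)
            = 32 / r * (ζ * partialInversion p S (unmatched T q₀ v) t).re := by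
          field_simp
        have e2 : lam * (residualMean T q₀ (golfingStep T q₀ p lam u v S) / 8)
            ≤ lam * (r / 8) - 2 := by
          calc _ ≤ lam * ((r - 16 / lam) / 8) := by gcongr
            _ = _ := by field_simp; ring
        have e3 := mul_le_mul_of_nonneg_left
          (mul_le_mul_of_nonneg_left hmin (by positivity : 0 ≤ 2 * u)) hlam.le
        linarith
      · rw [if_neg hS, golfingStep, if_neg hS]
        have : 0 ≤ P * (Real.exp (-2) *
            Real.exp (32 / r * (ζ * partialInversion p S (unmatched T q₀ v) t).re)) := by
          positivity
        linarith
    refine (bernoulliExp_mono h0.le h1 hpt).trans ?_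
    rw [bernoulliExp_mul_left, bernoulliExp_add, bernoulliExp_mul_left]
    have hE := sum_norm_sq_unmatched (q₀ := q₀) (v := v) hT
    rw [← hr] at hE
    have hexp := bernoulliExp_exp_partialInversion_le h0 h1
      (fun t ht => unmatched_of_notMem (q₀ := q₀) (v := v) ht) ht hζ (θ := 32 / r) (by positivity)
      (by
        rw [hE]
        calc (32 / r) ^ 2 * (T.card * (T.card * r ^ 2)) = (32 * T.card : ℝ) ^ 2 := by
              field_simp
          _ ≤ (p * N) ^ 2 := pow_le_pow_left₀ (by positivity) (by linarith) 2)
    have hexp' : Real.exp ((32 / r) ^ 2 * ((∑ t, ‖unmatched T q₀ v t‖ ^ 2) / (p * N)))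
        ≤ Real.exp 1 := by
      rw [Real.exp_le_exp, hE]
      calc (32 / r) ^ 2 * (T.card * r ^ 2 / (p * N)) = 1024 * T.card / (p * N) := by
            field_simp
            norm_num
        _ ≤ 1 := (div_le_one (by positivity)).2 hp
    have hskip := bernoulliExp_not_isUsable_le (q₀ := q₀) (v := v) (lam := lam) hT h1 hp hu hr0
    have h3 : Real.exp (-2) * Real.exp 1 ≤ 1 / 2 := by
      rw [← Real.exp_add, show (-2 : ℝ) + 1 = -1 by norm_num, Real.exp_neg, ← one_div]
      refine one_div_le_one_div_of_le (by norm_num) ?_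
      linarith [Real.add_one_le_exp (1 : ℝ)]
    have h4 := mul_le_mul_of_nonneg_left (hexp.trans hexp') (Real.exp_pos (-2)).le
    refine mul_le_of_le_one_right hPpos.le ?_
    linarith

open Classical in
/-- The time potential is halved on average in a step. -/
lemma bernoulliExp_timePotential_golfingStep_le (hT : T.Nonempty) (h1 : p ≤ 1)
    (hp : 1024 * (T.card : ℝ) ≤ p * N) (hu : u = 2 + (Real.log N + 10) / 512)
    (hlam : 0 < lam) :
    bernoulliExp p (fun S => timePotential lam ρ
        (residualMean T q₀ (golfingStep T q₀ p lam u v S)))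
      ≤ timePotential lam ρ (residualMean T q₀ v) / 2 := by
  have hN : (0 : ℝ) < N := by exact_mod_cast NeZero.pos N
  have hs : (0 : ℝ) < T.card := by exact_mod_cast hT.card_pos
  have h0 : 0 < p := by
    by_contra h
    nlinarith
  rcases (residualMean_nonneg (T := T) (q₀ := q₀) (v := v)).eq_or_lt with hr0 | hr0
  · simp only [golfingStep_of_residualMean_eq_zero hT hr0.symm]
    rw [bernoulliExp_const, ← hr0]
    simp [timePotential]
  set r := residualMean T q₀ v with hr
  set P := timePotential lam ρ r with hP
  have hPpos : 0 ≤ P := by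
    rw [hP, timePotential]
    positivity
  have hexp : Real.exp (-1) ≤ 0.37 := by
    have := Real.exp_neg_one_lt_d9
    linarith
  have hpt : ∀ S, timePotential lam ρ (residualMean T q₀ (golfingStep T q₀ p lam u v S))
      ≤ P * (0.37 + if IsUsable T q₀ p lam u v S then 0 else 1) := by
    intro S
    by_cases hS : IsUsable T q₀ p lam u v S
    · have hr' := residualMean_golfingStep_le hS
      have hr2 := residualMean_golfingStep_le_self (T := T) (q₀ := q₀) (p := p) (lam := lam)
        (u := u) (v := v) S
      have hr3 := residualMean_nonneg (T := T) (q₀ := q₀) (v := golfingStep T q₀ p lam u v S)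
      rw [← hr] at hr' hr2
      rw [if_pos hS, add_zero, hP, timePotential, timePotential]
      set r' := residualMean T q₀ (golfingStep T q₀ p lam u v S)
      by_cases hphase : lam * r ≤ 32
      · rw [stepSize, if_pos hphase] at hr'
        have h2 : (r' / ρ) ^ 2 ≤ (r / ρ) ^ 2 * 0.37 := by
          rw [div_pow, div_pow, div_mul_eq_mul_div]
          refine div_le_div_of_nonneg_right ?_ (sq_nonneg _)
          nlinarith
        calc (r' / ρ) ^ 2 * Real.exp (lam * r' / 16)
            ≤ ((r / ρ) ^ 2 * 0.37) * Real.exp (lam * r / 16) := by gcongr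
          _ = _ := by ring
      · push Not at hphase
        rw [stepSize, if_neg (not_le.2 hphase)] at hr'
        have h2 : (r' / ρ) ^ 2 ≤ (r / ρ) ^ 2 := by
          rw [div_pow, div_pow]
          refine div_le_div_of_nonneg_right ?_ (sq_nonneg _)
          gcongr
        have h3 : lam * r' / 16 ≤ -1 + lam * r / 16 := by
          calc lam * r' / 16 ≤ lam * ((1 - 32 / (lam * r) / 2) * r) / 16 := by gcongr
            _ = _ := by field_simp; ring
        calc (r' / ρ) ^ 2 * Real.exp (lam * r' / 16)
            ≤ (r / ρ) ^ 2 * Real.exp (-1 + lam * r / 16) := by gcongr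
          _ = ((r / ρ) ^ 2 * Real.exp (lam * r / 16)) * Real.exp (-1) := by
              rw [Real.exp_add]; ring
          _ ≤ _ := mul_le_mul_of_nonneg_left hexp hPpos
    · rw [if_neg hS, golfingStep, if_neg hS]
      linarith
  refine (bernoulliExp_mono h0.le h1 hpt).trans ?_
  rw [bernoulliExp_mul_left, bernoulliExp_add, bernoulliExp_const]
  have hskip := bernoulliExp_not_isUsable_le (q₀ := q₀) (v := v) (lam := lam) hT h1 hp hu hr0
  calc _ ≤ P * (0.37 + 1 / 100) := by gcongr
    _ ≤ P / 2 := by linarith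

/-- The set `Ω` carries a dual vector that interpolates `q₀` on `T` within `ε` and is bounded by
`2 / 3` outside `T`. -/
def HasDualCertificate (T : Finset (ZMod N)) (q₀ : ZMod N → ℂ) (ε : ℝ) (Ω : Set (ZMod N)) : Prop :=
  ∃ v, AnnihilatesKernel Ω v ∧ (∀ t ∈ T, ‖q₀ t - v t‖ ≤ ε) ∧ ∀ t ∉ T, ‖v t‖ ≤ 2 / 3

open Classical in
/-- The potential of the dual vector `v` bounds the probability that `n` further independent samples
do not suffice to turn it into a dual certificate. -/
lemma bernoulliExp_not_hasDualCertificate_le_potential (hT : T.Nonempty) (h1 : p ≤ 1)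
    (hp : 1024 * (T.card : ℝ) ≤ p * N) (hu : u = 2 + (Real.log N + 10) / 512)
    (hlam : 0 < lam) (hρ : 0 < ρ) (n : ℕ) (v : ZMod N → ℂ) (Ω : Finset (ZMod N))
    (hv : AnnihilatesKernel (Ω : Set (ZMod N)) v) :
    bernoulliExp (1 - (1 - p) ^ n) (fun S : Finset (ZMod N) =>
        if HasDualCertificate T q₀ (N * ρ) ((Ω ∪ S : Finset (ZMod N)) : Set (ZMod N))
          then 0 else 1)
      ≤ ∑ t ∈ Tᶜ, ∑ j ∈ Finset.range 4,
          sizePotential lam u (residualMean T q₀ v) (Complex.I ^ j * v t).re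
        + timePotential lam ρ (residualMean T q₀ v) / 2 ^ n := by
  have hN : (0 : ℝ) < N := by exact_mod_cast NeZero.pos N
  have hs : (0 : ℝ) < T.card := by exact_mod_cast hT.card_pos
  have h0 : 0 < p := by
    by_contra h
    nlinarith
  have hu0 : 0 ≤ u := by
    have := Real.log_natCast_nonneg N
    rw [hu]
    positivity
  induction n generalizing v Ω with
  | zero =>
    rw [pow_zero, sub_self, bernoulliExp_zero, Finset.union_empty, pow_zero, div_one]
    set r := residualMean T q₀ v with hr
    have hr0 : 0 ≤ r := residualMean_nonneg
    have hA : 0 ≤ ∑ t ∈ Tᶜ, ∑ j ∈ Finset.range 4,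
        sizePotential lam u r (Complex.I ^ j * v t).re :=
      Finset.sum_nonneg fun t _ => Finset.sum_nonneg fun j _ => (Real.exp_pos _).le
    have hB : 0 ≤ timePotential lam ρ r := by
      unfold timePotential
      positivity
    split_ifs with hcert
    · exact add_nonneg hA hB
    by_cases hrρ : r ≤ ρ
    · have hon : ∀ t ∈ T, ‖q₀ t - v t‖ ≤ N * ρ := by
        intro t ht
        have h2 : ‖unmatched T q₀ v t‖ ^ 2 ≤ ∑ t, ‖unmatched T q₀ v t‖ ^ 2 :=
          Finset.single_le_sum (f := fun t => ‖unmatched T q₀ v t‖ ^ 2)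
            (fun t _ => by positivity) (Finset.mem_univ t)
        rw [sum_norm_sq_unmatched hT, ← hr, unmatched, if_pos ht] at h2
        have hcard : (T.card : ℝ) ≤ N := by
          have := Finset.card_le_univ T
          rw [ZMod.card] at this
          exact_mod_cast this
        have hN1 : (1 : ℝ) ≤ N := by exact_mod_cast NeZero.one_le
        refine abs_le_of_sq_le_sq' (h2.trans ?_) (by positivity) |>.2
        calc (T.card : ℝ) * r ^ 2 ≤ N * ρ ^ 2 := by gcongr
          _ ≤ N ^ 2 * ρ ^ 2 := by
              gcongr
              nlinarith
          _ = _ := by ring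
      have hoff : ∃ t ∉ T, 2 / 3 < ‖v t‖ := by
        by_contra! h
        exact hcert ⟨v, hv, hon, h⟩
      obtain ⟨t, ht, hvt⟩ := hoff
      obtain ⟨j, hj, h4⟩ := exists_norm_le_two_mul_re (v t)
      refine le_trans ?_ (le_add_of_nonneg_right hB)
      refine le_trans ?_ (Finset.single_le_sum (fun t _ => Finset.sum_nonneg fun j _ =>
        (Real.exp_pos _).le) (Finset.mem_compl.2 ht))
      refine le_trans ?_ (Finset.single_le_sum (fun j _ => (Real.exp_pos _).le) hj)
      refine Real.one_le_exp (mul_nonneg hlam.le ?_)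
      have : 0 ≤ 2 * u * min r (32 / lam) :=
        mul_nonneg (by positivity) (le_min hr0 (by positivity))
      linarith
    · push Not at hrρ
      refine le_trans ?_ (le_add_of_nonneg_left hA)
      unfold timePotential
      have h2 : 1 ≤ r / ρ := (one_le_div hρ).2 hrρ.le
      exact one_le_mul_of_one_le_of_one_le (one_le_pow₀ h2) (Real.one_le_exp (by positivity))
  | succ n ih =>
    have hpn : (1 : ℝ) - (1 - p) ^ (n + 1) = 1 - (1 - p) * (1 - (1 - (1 - p) ^ n)) := by ring
    rw [hpn, ← bernoulliExp_union]
    calc _ ≤ bernoulliExp p (fun S => ∑ t ∈ Tᶜ, ∑ j ∈ Finset.range 4,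
            sizePotential lam u (residualMean T q₀ (golfingStep T q₀ p lam u v S))
              (Complex.I ^ j * golfingStep T q₀ p lam u v S t).re
          + 1 / 2 ^ n * timePotential lam ρ
              (residualMean T q₀ (golfingStep T q₀ p lam u v S))) := by
          refine bernoulliExp_mono h0.le h1 fun S => ?_
          have h2 := ih (golfingStep T q₀ p lam u v S) (Ω ∪ S) (by
            rw [Finset.coe_union]
            exact hv.golfingStep S)
          simp only [Finset.union_assoc] at h2
          rw [one_div_mul_eq_div]
          exact h2
      _ ≤ _ := by
          rw [bernoulliExp_add, bernoulliExp_sum p Tᶜ, bernoulliExp_mul_left]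
          refine add_le_add (Finset.sum_le_sum fun t ht => ?_) ?_
          · rw [bernoulliExp_sum]
            exact Finset.sum_le_sum fun j _ => bernoulliExp_sizePotential_golfingStep_le hT h1 hp
              hu hlam (Finset.mem_compl.1 ht) (by simp)
          · calc _ ≤ 1 / 2 ^ n * (timePotential lam ρ (residualMean T q₀ v) / 2) :=
                  mul_le_mul_of_nonneg_left
                    (bernoulliExp_timePotential_golfingStep_le hT h1 hp hu hlam) (by positivity)
              _ = _ := by
                  rw [pow_succ]
                  field_simp

end Potential

/-! ### From dual certificates to recovery -/

section Recovery

variable {N : ℕ} [NeZero N] {Ω : Set (ZMod N)}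

/-- A perturbation invisible on `Ω` pairs with a certified pattern only through the defects of the
certificate. -/
lemma HasDualCertificate.norm_sum_le {T : Finset (ZMod N)} {q : ZMod N → ℂ} {ε : ℝ}
    (h : HasDualCertificate T q ε Ω) {δ : ZMod N → ℂ} (hδ : ∀ k ∈ Ω, 𝓕 δ k = 0) :
    ‖∑ t ∈ T, starRingEnd ℂ (q t) * δ t‖
      ≤ ε * ∑ t ∈ T, ‖δ t‖ + 2 / 3 * ∑ t ∈ Tᶜ, ‖δ t‖ := by
  obtain ⟨v, hv, hon, hoff⟩ := h
  have h0 := hv δ hδ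
  rw [← Finset.sum_add_sum_compl T] at h0
  have h1 : ∑ t ∈ T, starRingEnd ℂ (q t) * δ t
      = ∑ t ∈ T, starRingEnd ℂ (q t - v t) * δ t - ∑ t ∈ Tᶜ, starRingEnd ℂ (v t) * δ t := by
    simp only [map_sub, sub_mul, Finset.sum_sub_distrib]
    linear_combination h0
  rw [h1, Finset.mul_sum, Finset.mul_sum]
  refine (norm_sub_le _ _).trans (add_le_add ?_ ?_)
  · refine (_root_.norm_sum_le _ _).trans (Finset.sum_le_sum fun t ht => ?_)
    rw [norm_mul, RCLike.norm_conj]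
    exact mul_le_mul_of_nonneg_right (hon t ht) (norm_nonneg _)
  · refine (_root_.norm_sum_le _ _).trans (Finset.sum_le_sum fun t ht => ?_)
    rw [norm_mul, RCLike.norm_conj]
    exact mul_le_mul_of_nonneg_right (hoff t (Finset.mem_compl.1 ht)) (norm_nonneg _)

/-- Dual certificates for the sign pattern of `x` and for the unit vectors of its support make `x`
the unique `ℓ¹`-minimizer among the signals with the same Fourier transform on `Ω`. Those for the
unit vectors replace a lower bound for the singular values of the partial Fourier matrix: they
bound a perturbation on the support by its values outside. -/
lemma eq_zero_of_hasDualCertificate {T : Finset (ZMod N)} {x : ZMod N → ℂ}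
    (hx : ∀ t ∉ T, x t = 0)
    (hsign : HasDualCertificate T (fun t => x t / ‖x t‖) (1 / (4 * N)) Ω)
    (hunit : ∀ j ∈ T, HasDualCertificate T (Pi.single j 1) (1 / (4 * N)) Ω)
    {δ : ZMod N → ℂ} (hδ : ∀ k ∈ Ω, 𝓕 δ k = 0) (hle : ∑ t, ‖x t + δ t‖ ≤ ∑ t, ‖x t‖) :
    δ = 0 := by
  have hN : (0 : ℝ) < N := by exact_mod_cast NeZero.pos N
  have hcard : (T.card : ℝ) ≤ N := by
    have := Finset.card_le_univ T
    rw [ZMod.card] at this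
    exact_mod_cast this
  set a := ∑ t ∈ T, ‖δ t‖ with ha
  set b := ∑ t ∈ Tᶜ, ‖δ t‖ with hb
  have ha0 : 0 ≤ a := Finset.sum_nonneg fun t _ => norm_nonneg _
  have hb0 : 0 ≤ b := Finset.sum_nonneg fun t _ => norm_nonneg _
  have hj : ∀ j ∈ T, ‖δ j‖ ≤ 1 / (4 * N) * a + 2 / 3 * b := by
    intro j hjT
    have h := (hunit j hjT).norm_sum_le hδ
    rwa [Finset.sum_eq_single j (fun t _ ht => by simp [ht]) (fun h => absurd hjT h),
      Pi.single_eq_same, map_one, one_mul] at h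
  have hab : a ≤ 8 / 9 * N * b := by
    have h1 : a ≤ N * (1 / (4 * N) * a + 2 / 3 * b) := by
      refine (Finset.sum_le_card_nsmul _ _ _ hj).trans ?_
      rw [nsmul_eq_mul]
      gcongr
    have h2 : N * (1 / (4 * N) * a + 2 / 3 * b) = a / 4 + 2 / 3 * (N * b) := by
      field_simp
    linarith
  have hs := hsign.norm_sum_le hδ
  have hT1 : ∑ t ∈ T, ‖x t‖ + (∑ t ∈ T, starRingEnd ℂ (x t / ‖x t‖) * δ t).re
      ≤ ∑ t ∈ T, ‖x t + δ t‖ := by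
    rw [Complex.re_sum, ← Finset.sum_add_distrib]
    refine Finset.sum_le_sum fun t _ => ?_
    by_cases hxt : x t = 0
    · simp [hxt]
    have hn : (‖x t‖ : ℂ) ≠ 0 := by exact_mod_cast norm_ne_zero_iff.2 hxt
    have h1 : starRingEnd ℂ (x t / ‖x t‖) * x t = ‖x t‖ := by
      rw [map_div₀, Complex.conj_ofReal, div_mul_eq_mul_div, Complex.conj_mul']
      field_simp
    have h2 : ‖starRingEnd ℂ (x t / ‖x t‖)‖ = 1 := by
      rw [RCLike.norm_conj, norm_div, Complex.norm_real, norm_norm,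
        div_self (norm_ne_zero_iff.2 hxt)]
    calc ‖x t‖ + (starRingEnd ℂ (x t / ‖x t‖) * δ t).re
        = (starRingEnd ℂ (x t / ‖x t‖) * (x t + δ t)).re := by
          rw [mul_add, h1, Complex.add_re, Complex.ofReal_re]
      _ ≤ ‖starRingEnd ℂ (x t / ‖x t‖) * (x t + δ t)‖ := Complex.re_le_norm _
      _ = ‖x t + δ t‖ := by rw [norm_mul, h2, one_mul]
  have hT2 : ∑ t ∈ Tᶜ, ‖x t + δ t‖ = b :=
    Finset.sum_congr rfl fun t ht => by rw [hx t (Finset.mem_compl.1 ht), zero_add]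
  have hT3 : ∑ t ∈ Tᶜ, ‖x t‖ = 0 :=
    Finset.sum_eq_zero fun t ht => by rw [hx t (Finset.mem_compl.1 ht), norm_zero]
  rw [← Finset.sum_add_sum_compl T, ← Finset.sum_add_sum_compl T (fun t => ‖x t‖), hT2, hT3] at hle
  have hre := (abs_le.1 (Complex.abs_re_le_norm
    (∑ t ∈ T, starRingEnd ℂ (x t / ‖x t‖) * δ t))).1
  have hεa : 1 / (4 * N) * a ≤ 2 / 9 * b := by
    calc 1 / (4 * N) * a ≤ 1 / (4 * N) * (8 / 9 * N * b) := by gcongr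
      _ = _ := by field_simp; ring
  have hbz : b = 0 := by linarith
  have haz : a = 0 := by
    rw [hbz] at hab
    linarith
  funext t
  by_cases ht : t ∈ T
  · exact norm_eq_zero.1 ((Finset.sum_eq_zero_iff_of_nonneg fun t _ => norm_nonneg _).1 haz t ht)
  · exact norm_eq_zero.1 ((Finset.sum_eq_zero_iff_of_nonneg fun t _ => norm_nonneg _).1 hbz t
      (Finset.mem_compl.2 ht))

lemma dft_sub_shift (h : ZMod N → ℂ) (k : ZMod N) :
    𝓕 (fun t => h t - h (t - 1)) k = (1 - ZMod.stdAddChar (-k)) * 𝓕 h k := by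
  simp only [ZMod.dft_apply, smul_eq_mul, mul_sub, Finset.sum_sub_distrib, sub_mul, one_mul]
  congr 1
  rw [Finset.mul_sum, ← Equiv.sum_comp (Equiv.addRight (1 : ZMod N))]
  refine Finset.sum_congr rfl fun t _ => ?_
  rw [Equiv.coe_addRight, add_sub_cancel_right, ← mul_assoc, ← AddChar.map_add_eq_mul]
  congr 2
  ring

lemma eq_apply_zero_of_sub_shift_eq_zero {h : ZMod N → ℂ} (hh : ∀ t, h t - h (t - 1) = 0)
    (t : ZMod N) : h t = h 0 := by
  have hnat : ∀ n : ℕ, h (n : ZMod N) = h 0 := by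
    intro n
    induction n with
    | zero => simp
    | succ n ih =>
      have h1 := hh ((n + 1 : ℕ) : ZMod N)
      rw [sub_eq_zero] at h1
      rw [h1, ← ih]
      push_cast
      rw [add_sub_cancel_right]
  rw [← ZMod.natCast_zmod_val t]
  exact hnat _

/-- Total-variation recovery of `f` follows from `ℓ¹` recovery of its difference signal. -/
lemma tvRecovers_of_l1_unique {f : ZMod N → ℂ}
    (H : ∀ δ : ZMod N → ℂ, (∀ k ∈ Ω, 𝓕 δ k = 0) →
      ∑ t, ‖f t - f (t - 1) + δ t‖ ≤ ∑ t, ‖f t - f (t - 1)‖ → δ = 0) :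
    TVRecovers Ω f := by
  have key : ∀ g ∈ feasibleSet Ω f, totalVariation g ≤ totalVariation f →
      ∀ t, (g t - f t) - (g (t - 1) - f (t - 1)) = 0 := by
    intro g hg hle
    have hz := H (fun t => (g t - f t) - (g (t - 1) - f (t - 1))) (fun k hk => by
      have h1 : 𝓕 g k = 𝓕 f k := hg hk
      have h2 := dft_sub_shift (g - f) k
      rw [map_sub, Pi.sub_apply, h1, sub_self, mul_zero] at h2
      exact h2) (by
      refine le_trans (le_of_eq ?_) hle
      exact Finset.sum_congr rfl fun t _ => by congr 1; ring)
    exact fun t => congrFun hz t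
  have hf : f ∈ feasibleSet Ω f := fun k _ => rfl
  ext g
  simp only [Set.mem_ofPred_eq, Set.mem_singleton_iff]
  constructor
  · rintro ⟨⟨hg, hmin⟩, hsum⟩
    have hconst := eq_apply_zero_of_sub_shift_eq_zero (h := fun t => g t - f t)
      (key g hg (hmin hf))
    have hN : (N : ℂ) ≠ 0 := NeZero.ne _
    have h0 : (N : ℂ) * (g 0 - f 0) = 0 := by
      rw [ZMod.dft_apply_zero] at hsum
      calc (N : ℂ) * (g 0 - f 0) = ∑ t : ZMod N, (g t - f t) := by
            rw [Finset.sum_congr rfl fun t _ => hconst t]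
            simp [mul_sub]
        _ = 0 := by rw [Finset.sum_sub_distrib, hsum, sub_self]
    have h1 := (mul_eq_zero.1 h0).resolve_left hN
    funext t
    have h2 := hconst t
    simp only [h1] at h2
    exact sub_eq_zero.1 h2
  · rintro rfl
    refine ⟨⟨hf, fun g' hg' => ?_⟩, (ZMod.dft_apply_zero g).symm⟩
    by_contra hlt
    have hlt' : totalVariation g' < totalVariation g := not_le.1 hlt
    have hz := key g' hg' hlt'.le
    refine hlt'.ne (Finset.sum_congr rfl fun t _ => ?_)
    congr 1
    linear_combination hz t

open Classical in
/-- A fixed bounded sign pattern on `T` has a dual certificate with high probability. The random set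
is the union of `n ≈ 300 (M + 1) log N` independent samples, each of which still has a large
constant times `|T|` elements on average. -/
lemma bernoulliExp_not_hasDualCertificate_le (hN2 : 2 ≤ N) {M τ : ℝ} (hM : 0 < M) (hτ0 : 0 < τ)
    (hτ1 : τ < 1) {T : Finset (ZMod N)}
    (hT : (T.card : ℝ) ≤ 1 / 400000 / (M + 1) * (Real.log N)⁻¹ * (τ * N))
    {q : ZMod N → ℂ} (hq : ∀ t ∈ T, ‖q t‖ ≤ 1) :
    bernoulliExp τ (fun S : Finset (ZMod N) =>
        if HasDualCertificate T q (1 / (4 * N)) (S : Set (ZMod N)) then 0 else 1)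
      ≤ 20 * Real.exp (-(2 * ((M + 1) * Real.log N))) := by
  rcases T.eq_empty_or_nonempty with rfl | hTne
  · have h : ∀ S : Finset (ZMod N),
        HasDualCertificate ∅ q (1 / (4 * N)) (S : Set (ZMod N)) := fun S =>
      ⟨0, AnnihilatesKernel.zero _, by simp, fun t _ => by simp; norm_num⟩
    simp only [h, if_true, bernoulliExp_const]
    positivity
  have hN : (0 : ℝ) < N := by positivity
  have hs : (0 : ℝ) < T.card := by exact_mod_cast hTne.card_pos
  set L := Real.log N with hL
  have hNexp : (N : ℝ) = Real.exp L := (Real.exp_log hN).symm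
  have hL2 : 1 / 2 ≤ L := by
    have h1 : Real.log 2 ≤ L := Real.log_le_log (by norm_num) (by exact_mod_cast hN2)
    linarith [Real.log_two_gt_d9]
  set y := (M + 1) * L with hy
  have hyL : L ≤ y := by nlinarith
  set n := ⌈300 * y⌉₊ with hn
  have hn1 : 300 * y ≤ n := Nat.le_ceil _
  have hn2 : (n : ℝ) ≤ 302 * y := by
    have := Nat.ceil_lt_add_one (show 0 ≤ 300 * y by linarith)
    linarith
  have hnpos : (0 : ℝ) < n := by linarith
  have hn0 : n ≠ 0 := by
    rintro h
    rw [h] at hnpos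
    simp at hnpos
  -- The parameter of one sample, chosen so that the union of `n` samples has parameter `τ`.
  set p : ℝ := 1 - (1 - τ) ^ ((n : ℝ)⁻¹) with hp
  have hpow : (1 - p) ^ n = 1 - τ := by
    rw [hp, sub_sub_cancel, Real.rpow_inv_natCast_pow (by linarith) hn0]
  have hp1 : p ≤ 1 := by
    have := Real.rpow_nonneg (show 0 ≤ 1 - τ by linarith) ((n : ℝ)⁻¹)
    linarith
  -- Bernoulli's inequality gives `(1 - p)ⁿ = 1 - τ ≤ (1 - τ/n)ⁿ`.
  have hpn : τ / n ≤ p := by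
    have hn1' : (1 : ℝ) ≤ n := by exact_mod_cast Nat.one_le_iff_ne_zero.2 hn0
    have hτn : τ / n ≤ 1 := (div_le_one hnpos).2 (by linarith)
    have h1 := one_add_mul_le_pow (show (-2 : ℝ) ≤ -(τ / n) by linarith) n
    have h2 : (1 : ℝ) + n * -(τ / n) = 1 - τ := by field_simp; ring
    rw [h2, ← hpow, ← sub_eq_add_neg] at h1
    have h3 := (pow_le_pow_iff_left₀ (by linarith) (by linarith) hn0).1 h1
    linarith
  have hpN : 1024 * (T.card : ℝ) ≤ p * N := by
    have hy0 : 0 < y := by linarith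
    calc 1024 * (T.card : ℝ) ≤ 1024 * (1 / 400000 / (M + 1) * L⁻¹ * (τ * N)) := by gcongr
      _ = 1024 / 400000 * (τ * N) / y := by
          rw [hy]
          field_simp
      _ ≤ 1 / 302 * (τ * N) / y := by
          refine div_le_div_of_nonneg_right ?_ hy0.le
          exact mul_le_mul_of_nonneg_right (by norm_num) (by positivity)
      _ = τ / (302 * y) * N := by field_simp
      _ ≤ τ / n * N := by gcongr
      _ ≤ p * N := by gcongr
  set lam : ℝ := 2100 * y with hlam
  have hlam0 : 0 < lam := by linarith
  set u : ℝ := 2 + (Real.log N + 10) / 512 with hu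
  set ρ : ℝ := 1 / (4 * N ^ 2) with hρ
  have hρ0 : 0 < ρ := by positivity
  have hε : (N : ℝ) * ρ = 1 / (4 * N) := by
    rw [hρ]
    field_simp
  have key := bernoulliExp_not_hasDualCertificate_le_potential (q₀ := q) hTne hp1 hpN hu hlam0 hρ0
    n 0 ∅ (AnnihilatesKernel.zero _)
  simp only [Finset.empty_union, hpow, sub_sub_cancel, hε] at key
  refine key.trans ?_
  set r := residualMean T q 0 with hr
  have hr0 : 0 ≤ r := residualMean_nonneg
  have hr1 : r ≤ 1 := by
    rw [hr, residualMean, Real.sqrt_le_left zero_le_one, one_pow, div_le_one hs,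
      ← Finset.sum_subset (Finset.subset_univ T)
        (fun t _ ht => by rw [unmatched_of_notMem ht]; simp)]
    refine (Finset.sum_le_card_nsmul T _ 1 fun t ht => ?_).trans_eq (by simp)
    simp only [unmatched, ht, if_true, Pi.zero_apply, sub_zero]
    exact pow_le_one₀ (norm_nonneg _) (hq t ht)
  have hsize : ∑ t ∈ Tᶜ, ∑ j ∈ Finset.range 4,
      sizePotential lam u r (Complex.I ^ j * (0 : ZMod N → ℂ) t).re ≤ 4 * Real.exp (-(2 * y)) := by
    have hterm : sizePotential lam u r 0 ≤ Real.exp (-(175 * y)) := by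
      refine Real.exp_le_exp.2 ?_
      have h1 : min r (32 / lam) ≤ 32 / lam := min_le_right _ _
      have hu0 : 0 ≤ u := by rw [hu]; positivity
      have h2 : lam * (2 * u * min r (32 / lam)) ≤ 64 * u := by
        calc _ ≤ lam * (2 * u * (32 / lam)) := by gcongr
          _ = _ := by field_simp; ring
      have h3 : 64 * u ≤ lam / 8 := by
        rw [hu, hlam]
        linarith
      have h4 : lam * (r / 8) ≤ lam / 8 := by nlinarith
      calc lam * (0 + r / 8 + 2 * u * min r (32 / lam) - 1 / 3)
          = lam * (r / 8) + lam * (2 * u * min r (32 / lam)) - lam / 3 := by ring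
        _ ≤ -(175 * y) := by
          rw [hlam] at h2 h3 h4 ⊢
          linarith
    have hpos : 0 ≤ sizePotential lam u r 0 := (Real.exp_pos _).le
    simp only [Pi.zero_apply, mul_zero, Complex.zero_re, Finset.sum_const, Finset.card_range,
      nsmul_eq_mul]
    have hc : ((Tᶜ).card : ℝ) ≤ N := by
      have := Finset.card_le_univ (Tᶜ)
      rw [ZMod.card] at this
      exact_mod_cast this
    calc ((Tᶜ).card : ℝ) * ((4 : ℕ) * sizePotential lam u r 0)
        ≤ Real.exp L * (4 * Real.exp (-(175 * y))) := by
          rw [← hNexp]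
          push_cast
          gcongr
      _ = 4 * Real.exp (L + -(175 * y)) := by rw [Real.exp_add]; ring
      _ ≤ 4 * Real.exp (-(2 * y)) := by
          gcongr
          linarith
  have htime : timePotential lam ρ r / 2 ^ n ≤ 16 * Real.exp (-(2 * y)) := by
    have h2 : Real.exp (207 * y) ≤ 2 ^ n := by
      rw [← Real.exp_log (show (0 : ℝ) < 2 by norm_num), ← Real.exp_nat_mul]
      refine Real.exp_le_exp.2 ?_
      nlinarith [Real.log_two_gt_d9]
    have h3 : timePotential lam ρ r ≤ 16 * Real.exp (4 * L + 132 * y) := by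
      calc (r / ρ) ^ 2 * Real.exp (lam * r / 16)
          ≤ (1 / ρ) ^ 2 * Real.exp (lam * 1 / 16) := by gcongr
        _ = 16 * (N ^ 4 * Real.exp (lam * 1 / 16)) := by
            rw [hρ]
            field_simp
            norm_num
        _ = 16 * Real.exp (4 * L + lam * 1 / 16) := by
            rw [hNexp, ← Real.exp_nat_mul, ← Real.exp_add]
            norm_num
        _ ≤ _ := by
            gcongr
            rw [hlam]
            linarith
    rw [div_le_iff₀ (by positivity)]
    calc _ ≤ 16 * Real.exp (4 * L + 132 * y) := h3
      _ ≤ 16 * Real.exp (-(2 * y) + 207 * y) :=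
          mul_le_mul_of_nonneg_left (Real.exp_le_exp.2 (by linarith)) (by norm_num)
      _ = 16 * Real.exp (-(2 * y)) * Real.exp (207 * y) := by rw [Real.exp_add]; ring
      _ ≤ _ := by gcongr
  linarith

end Recovery

theorem mainTheorem5 :
    ∃ c : ℝ, 0 < c ∧
      ∀ M : ℝ, 0 < M →
        ∃ C : ℝ, 0 < C ∧
          ∀ (N : ℕ) [NeZero N], 2 ≤ N →
            ∀ τ : unitInterval, 0 < τ → τ < 1 →
              ∀ f : ZMod N → ℂ,
                ((jumpSet f).ncard : ℝ) ≤
                    c / (M + 1) * (Real.log (N : ℝ))⁻¹ * ((τ : ℝ) * (N : ℝ)) →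
                  1 - C * (N : ℝ) ^ (-M) ≤
                    (randomFrequencies N τ).real {Ω | TVRecovers Ω f} := by
  classical
  refine ⟨1 / 400000, by norm_num, fun M hM => ⟨40, by norm_num, ?_⟩⟩
  intro N _ hN2 τ hτ0 hτ1 f hf
  have hN : (0 : ℝ) < N := by positivity
  have hτ0' : (0 : ℝ) < τ := hτ0
  have hτ1' : (τ : ℝ) < 1 := hτ1
  set T : Finset (ZMod N) := (jumpSet f).toFinset with hTdef
  rw [Set.ncard_eq_toFinset_card'] at hf
  set x : ZMod N → ℂ := fun t => f t - f (t - 1) with hx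
  have hxT : ∀ t ∉ T, x t = 0 := fun t ht => by
    rw [hTdef, Set.mem_toFinset, jumpSet, Set.mem_ofPred_eq, not_not] at ht
    exact sub_eq_zero.2 ht
  set β := 20 * Real.exp (-(2 * ((M + 1) * Real.log N))) with hβ
  have hsign := bernoulliExp_not_hasDualCertificate_le hN2 hM hτ0' hτ1' hf
    (q := fun t => x t / ‖x t‖) (fun t _ => by
      rw [norm_div, Complex.norm_real, norm_norm]
      exact div_self_le_one _)
  have hunit : ∀ j ∈ T, _ := fun j _ => bernoulliExp_not_hasDualCertificate_le hN2 hM hτ0' hτ1' hf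
    (q := Pi.single j 1) (fun t _ => by
      by_cases h : t = j
      · subst h
        simp
      · simp [h])
  rw [randomFrequencies, setBernoulli_real_eq_bernoulliExp]
  have hpt : ∀ S : Finset (ZMod N), (1 : ℝ) ≤ (if TVRecovers (S : Set (ZMod N)) f then 1 else 0)
      + ((if HasDualCertificate T (fun t => x t / ‖x t‖) (1 / (4 * N)) (S : Set (ZMod N))
          then 0 else 1)
        + ∑ j ∈ T, if HasDualCertificate T (Pi.single j 1) (1 / (4 * N)) (S : Set (ZMod N))
          then 0 else 1) := by
    intro S
    have h0 : ∀ j ∈ T, (0 : ℝ) ≤ if HasDualCertificate T (Pi.single j 1) (1 / (4 * N))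
        (S : Set (ZMod N)) then 0 else 1 := fun j _ => by split_ifs <;> norm_num
    have hsum := Finset.sum_nonneg h0
    by_cases h1 : HasDualCertificate T (fun t => x t / ‖x t‖) (1 / (4 * N)) (S : Set (ZMod N))
    · by_cases h2 : ∀ j ∈ T, HasDualCertificate T (Pi.single j 1) (1 / (4 * N)) (S : Set (ZMod N))
      · rw [if_pos (tvRecovers_of_l1_unique fun δ hδ hle =>
          eq_zero_of_hasDualCertificate hxT h1 h2 hδ hle), if_pos h1]
        linarith
      · push Not at h2
        obtain ⟨j, hj, h3⟩ := h2
        have h4 := Finset.single_le_sum h0 hj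
        rw [if_neg h3] at h4
        have h5 : (0 : ℝ) ≤ if TVRecovers (S : Set (ZMod N)) f then 1 else 0 := by
          split_ifs <;> norm_num
        rw [if_pos h1]
        linarith
    · have h5 : (0 : ℝ) ≤ if TVRecovers (S : Set (ZMod N)) f then 1 else 0 := by
        split_ifs <;> norm_num
      rw [if_neg h1]
      linarith
  have h1 := bernoulliExp_mono hτ0'.le hτ1'.le hpt
  rw [bernoulliExp_const, bernoulliExp_add, bernoulliExp_add, bernoulliExp_sum] at h1
  have h2 := Finset.sum_le_card_nsmul T _ β hunit
  rw [nsmul_eq_mul] at h2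
  have hcard : (T.card : ℝ) ≤ N := by
    have := Finset.card_le_univ T
    rw [ZMod.card] at this
    exact_mod_cast this
  have hN1 : (1 : ℝ) ≤ N := by exact_mod_cast NeZero.one_le
  have hβ0 : 0 ≤ β := by positivity
  have hfinal : β + N * β ≤ 40 * (N : ℝ) ^ (-M) := by
    have hlog : 0 ≤ Real.log N := Real.log_natCast_nonneg N
    calc β + N * β ≤ N * β + N * β := by nlinarith
      _ = 40 * (Real.exp (Real.log N) * Real.exp (-(2 * ((M + 1) * Real.log N)))) := by
          rw [Real.exp_log hN, hβ]
          ring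
      _ ≤ 40 * (N : ℝ) ^ (-M) := by
          rw [← Real.exp_add, Real.rpow_def_of_pos hN]
          gcongr
          nlinarith [mul_nonneg hM.le hlog]
  have h3 : (T.card : ℝ) * β ≤ N * β := by gcongr
  linarith
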